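/- Let $X$ be a compact metric space with metric $d$ and $f:X\to X$ a homeomorphism. For $x\in X$ and $\delta>0$ put $\Gamma_\delta(x)=\{y\in X: d(f^i(x),f^i(y))\le\delta\ \text{for all } i\in\mathbb Z\}$. For $n\in\mathbb N=\{0,1,2,\dots\}$, $f$ is *$n$-expansive* if there is $\delta>0$ such that every $\Gamma_\delta(x)$ has at most $n$ elements; $f$ is *expansive* if there is $\delta>0$ with $\Gamma_\delta(x)=\{x\}$ for all $x\in X$; $f$ is *strongly measure expansive* if there is $\delta>0$ such that $\mu(\Gamma_\delta(x))=\mu(\{x\})$ for every $f$-invariant Borel probability measure $\mu$ and every $x\in X$. Let $\Omega(f)$ be the set of non-wandering points of $f$, i.e. of those $x$ such that for every open $V\ni x$ there is $n\ge 1$ with $f^n(V)\cap V\neq\emptyset$. It is called *isolated* if $\Omega(f)=\bigcap_{n\in\mathbb Z}f^n(U)$ for some open set $U\subset X$. For $N\in\mathbb N$ consider the following properties of $f$: (a) $f$ is $(N+1)$-expansive; (b) $f$ is not $N$-expansive; (c) the restriction $f|_{\Omega(f)}$ is expansive; (d) $\Omega(f)$ is isolated. (These are the properties of Artigue's homeomorphism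 $f_N$.) Then: 1. For every $N\in\mathbb N$, every homeomorphism of a compact metric space that has properties (a)–(d) is strongly measure expansive. 2. There are a compact metric space $S$ and, for each $N\in\mathbb N$, a homeomorphism $f_N:S\to S$ that has properties (a)–(d) and is strongly measure expansive; for $N\ge 1$ it is not expansive. 3. Consequently, strong measure expansiveness does not imply expansiveness for homeomorphisms of compact metric spaces. -/

import Mathlib

/-- The dynamical ball `Γ_δ(x, f)`: the points whose full orbit stays within distance `δ` of the
orbit of `x`. Powers are taken in the group of homeomorphisms of `X`. -/
def Gam {X : Type*} [MetricSpace X] (f : X ≃ₜ X) (δ : ℝ) (x : X) : Set X :=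
  {y | ∀ i : ℤ, dist ((f ^ i) x) ((f ^ i) y) ≤ δ}

/-- `f` is `n`-expansive: for some `δ > 0`, every `Γ_δ(x)` has at most `n` elements. -/
def IsNExpansive {X : Type*} [MetricSpace X] (n : ℕ) (f : X ≃ₜ X) : Prop :=
  ∃ δ : ℝ, 0 < δ ∧ ∀ x : X, (Gam f δ x).encard ≤ n

/-- The restriction of `f` to the set `A` is expansive: for some `δ > 0`, two points of `A` whose
full orbits stay within distance `δ` of each other are equal. Used for invariant sets `A`. -/
def IsExpansiveOn {X : Type*} [MetricSpace X] (f : X ≃ₜ X) (A : Set X) : Prop :=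
  ∃ δ : ℝ, 0 < δ ∧ ∀ x ∈ A, ∀ y ∈ A, y ∈ Gam f δ x → y = x

/-- `f` is expansive. -/
def IsExpansive {X : Type*} [MetricSpace X] (f : X ≃ₜ X) : Prop :=
  ∃ δ : ℝ, 0 < δ ∧ ∀ x y : X, y ∈ Gam f δ x → y = x

/-- The set `Ω(f)` of non-wandering points. -/
def nonwanderingSet {X : Type*} [TopologicalSpace X] (f : X ≃ₜ X) : Set X :=
  {x | ∀ V : Set X, IsOpen V → x ∈ V → ∃ n : ℕ, 1 ≤ n ∧ ((f ^ n) '' V ∩ V).Nonempty}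

/-- `A` is isolated: it is the intersection of all iterates of some open set. -/
def IsIsolatedSet {X : Type*} [TopologicalSpace X] (f : X ≃ₜ X) (A : Set X) : Prop :=
  ∃ U : Set X, IsOpen U ∧ A = ⋂ n : ℤ, (f ^ n) '' U

/-- `f` is strongly measure expansive: for some `δ > 0`, every `f`-invariant Borel probability
measure `μ` and every point `x` satisfy `μ (Γ_δ(x)) = μ {x}`. -/
def IsStronglyMeasureExpansive {X : Type*} [MetricSpace X] [MeasurableSpace X] [BorelSpace X]
    (f : X ≃ₜ X) : Prop :=
  ∃ δ : ℝ, 0 < δ ∧ ∀ μ : MeasureTheory.Measure X, MeasureTheory.IsProbabilityMeasure μ →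
    MeasureTheory.MeasurePreserving f μ μ → ∀ x : X, μ (Gam f δ x) = μ {x}

/-- The listed properties of the `N`-th homeomorphism of the family: it is `(N+1)`-expansive but
not `N`-expansive, it is expansive on its non-wandering set, and that set is isolated. -/
structure IsArtigue {X : Type*} [MetricSpace X] (N : ℕ) (f : X ≃ₜ X) : Prop where
  expansive_succ : IsNExpansive (N + 1) f
  not_expansive : ¬ IsNExpansive N f
  expansive_nonwandering : IsExpansiveOn f (nonwanderingSet f)
  isolated_nonwandering : IsIsolatedSet f (nonwanderingSet f)

open Topology MeasureTheory
open scoped OnePoint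

/-! For strong measure expansiveness: a small `Γ_δ(x)` is finite, so only atoms count. By Poincaré
recurrence an atom `y` of an invariant probability measure is periodic, so its orbit lies in `Ω(f)`.
If `y ∈ Γ_δ(x)`, the orbit of `x` stays near `Ω(f)`, so isolation puts `x` in `Ω(f)`, and
expansiveness there forces `y = x`. Thus `Γ_δ(x) \ {x}` is null
(`isStronglyMeasureExpansive_of_isNExpansive`).

The examples are symbolic. Shift the bi-infinite words with at most one marker of each of two kinds,
the second after the first, and take each word with both markers `N + 1` times. Every word except
the empty one wanders. The times at which a marker passes the origin determine the word but not its
copy, so at most `N + 1` points share an itinerary. When the markers are far apart, the copies of a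
word stay arbitrarily close along the whole orbit, so `N`-expansiveness fails. Topologically the
space is always the same countable compactum, whatever `N` is. -/

theorem Homeomorph.zpow_apply_of_semiconj {X : Type*} [TopologicalSpace X] (f : X ≃ₜ X)
    (u : ℤ → X) (hu : ∀ t, f (u t) = u (t + 1)) (i t : ℤ) : (f ^ i) (u t) = u (t + i) := by
  induction i using Int.induction_on generalizing t with
  | zero => simp
  | succ n ih =>
    rw [zpow_add_one]
    change (f ^ (n : ℤ)) (f (u t)) = _
    rw [hu, ih]; congr 1; ring
  | pred n ih =>
    have h : u t = f (u (t - 1)) := by rw [hu]; simp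
    rw [zpow_sub_one, h]
    change (f ^ (-n : ℤ)) (f.symm (f (u (t - 1)))) = _
    rw [f.symm_apply_apply, ih]; congr 1; ring

theorem Homeomorph.zpow_apply_of_fixed {X : Type*} [TopologicalSpace X] (f : X ≃ₜ X)
    {p : X} (hp : f p = p) (i : ℤ) : (f ^ i) p = p :=
  f.zpow_apply_of_semiconj (fun _ => p) (fun _ => hp) i 0

theorem mem_iInter_zpow_image_iff {X : Type*} [TopologicalSpace X] (f : X ≃ₜ X) (U : Set X)
    (x : X) : x ∈ ⋂ n : ℤ, (f ^ n) '' U ↔ ∀ n : ℤ, (f ^ n) x ∈ U := by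
  have key : ∀ n : ℤ, x ∈ (f ^ n) '' U ↔ (f ^ (-n)) x ∈ U := by
    intro n
    rw [zpow_neg]
    constructor
    · rintro ⟨y, hy, rfl⟩
      change (f ^ n).symm ((f ^ n) y) ∈ U
      rwa [(f ^ n).symm_apply_apply]
    · intro h
      exact ⟨_, h, (f ^ n).apply_symm_apply x⟩
  simp only [Set.mem_iInter, key]
  exact ⟨fun h n => by simpa using h (-n), fun h n => h _⟩

theorem IsNExpansive.mono {X : Type*} [MetricSpace X] {f : X ≃ₜ X} {m n : ℕ} (hmn : m ≤ n)
    (h : IsNExpansive m f) : IsNExpansive n f := by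
  obtain ⟨δ, hδ, h⟩ := h
  exact ⟨δ, hδ, fun x => (h x).trans (by exact_mod_cast hmn)⟩

theorem IsExpansive.isNExpansive_one {X : Type*} [MetricSpace X] {f : X ≃ₜ X}
    (h : IsExpansive f) : IsNExpansive 1 f := by
  obtain ⟨δ, hδ, h⟩ := h
  refine ⟨δ, hδ, fun x => ?_⟩
  calc (Gam f δ x).encard ≤ ({x} : Set X).encard :=
        Set.encard_le_encard fun y hy => h x y hy
    _ = ((1 : ℕ) : ℕ∞) := by simp

theorem Gam_mono {X : Type*} [MetricSpace X] (f : X ≃ₜ X) {δ ε : ℝ} (h : δ ≤ ε) (x : X) :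
    Gam f δ x ⊆ Gam f ε x := fun _ hy i => (hy i).trans h

theorem self_mem_Gam {X : Type*} [MetricSpace X] (f : X ≃ₜ X) {δ : ℝ} (h : 0 ≤ δ) (x : X) :
    x ∈ Gam f δ x := fun i => by simpa using h

/-! ### Invariant measures, recurrence and strong measure expansiveness -/

/-- An atom of an invariant finite measure is a periodic point. -/
theorem exists_pow_apply_eq_of_measure_singleton_ne_zero {X : Type*} [TopologicalSpace X]
    [MeasurableSpace X] [MeasurableSingletonClass X] (f : X ≃ₜ X) (μ : Measure X)
    [IsFiniteMeasure μ] (hf : MeasurePreserving f μ μ) {y : X} (hy : μ {y} ≠ 0) :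
    ∃ n : ℕ, 1 ≤ n ∧ (f ^ n) y = y := by
  have hcoe : ∀ n : ℕ, ∀ x : X, (f^[n]) x = (f ^ n) x := by
    intro n
    induction n with
    | zero => intro x; rfl
    | succ n ih => intro x; rw [Function.iterate_succ_apply, ih, pow_succ]; rfl
  -- Poincaré recurrence for the set `{y}`, which has positive measure.
  obtain ⟨x, hx, n, hn, hxn⟩ := hf.conservative.exists_mem_iterate_mem
    (measurableSet_singleton y).nullMeasurableSet hy
  rw [Set.mem_singleton_iff] at hx hxn
  subst hx
  exact ⟨n, Nat.one_le_iff_ne_zero.2 hn, (hcoe n _).symm.trans hxn⟩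

theorem mem_nonwanderingSet_of_pow_apply_eq {X : Type*} [TopologicalSpace X] (f : X ≃ₜ X) {y : X}
    {n : ℕ} (hn : 1 ≤ n) (hy : (f ^ n) y = y) : y ∈ nonwanderingSet f :=
  fun _ _ hyV => ⟨n, hn, y, ⟨y, hyV, hy⟩, hyV⟩

theorem isClosed_nonwanderingSet {X : Type*} [TopologicalSpace X] (f : X ≃ₜ X) :
    IsClosed (nonwanderingSet f) := by
  rw [← isOpen_compl_iff, isOpen_iff_forall_mem_open]
  intro x hx
  simp only [nonwanderingSet, Set.mem_compl_iff, Set.mem_ofPred_eq, not_forall] at hx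
  obtain ⟨V, hV, hxV, h⟩ := hx
  exact ⟨V, fun y hy hyΩ => h (hyΩ V hV hy), hV, hxV⟩

theorem isStronglyMeasureExpansive_of_isNExpansive {X : Type*} [MetricSpace X] [CompactSpace X]
    [MeasurableSpace X] [BorelSpace X] (N : ℕ) (f : X ≃ₜ X) (hN : IsNExpansive N f)
    (hexp : IsExpansiveOn f (nonwanderingSet f)) (hiso : IsIsolatedSet f (nonwanderingSet f)) :
    IsStronglyMeasureExpansive f := by
  obtain ⟨δ₁, hδ₁, h₁⟩ := hN
  obtain ⟨δ₂, hδ₂, h₂⟩ := hexp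
  obtain ⟨U, hU, hΩ⟩ := hiso
  have hΩU : nonwanderingSet f ⊆ U := by
    intro x hx
    rw [hΩ, mem_iInter_zpow_image_iff] at hx
    simpa using hx 0
  -- `Ω(f)` is compact, so the isolating set `U` contains a uniform neighbourhood of it.
  obtain ⟨δ₃, hδ₃, h₃⟩ :=
    (isClosed_nonwanderingSet f).isCompact.exists_cthickening_subset_open hU hΩU
  refine ⟨min δ₁ (min δ₂ δ₃), by positivity, fun μ hμ hf x => ?_⟩
  set δ := min δ₁ (min δ₂ δ₃) with hδ
  have hle₁ : δ ≤ δ₁ := min_le_left _ _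
  have hle₂ : δ ≤ δ₂ := (min_le_right _ _).trans (min_le_left _ _)
  have hle₃ : δ ≤ δ₃ := (min_le_right _ _).trans (min_le_right _ _)
  have hfin : (Gam f δ x).Finite :=
    (Set.finite_of_encard_le_coe (h₁ x)).subset (Gam_mono f hle₁ x)
  have hzero : ∀ y ∈ Gam f δ x, y ≠ x → μ {y} = 0 := by
    intro y hy hyx
    by_contra h0
    obtain ⟨n, hn, hyn⟩ := exists_pow_apply_eq_of_measure_singleton_ne_zero f μ hf h0
    have hyΩ : y ∈ nonwanderingSet f := mem_nonwanderingSet_of_pow_apply_eq f hn hyn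
    have hiter : ∀ i : ℤ, (f ^ i) y ∈ nonwanderingSet f := by
      intro i
      refine mem_nonwanderingSet_of_pow_apply_eq f hn ?_
      change (f ^ n * f ^ i) y = _
      rw [← zpow_natCast, ← zpow_add, add_comm, zpow_add, zpow_natCast]
      change (f ^ i) ((f ^ n) y) = _
      rw [hyn]
    -- The orbit of `x` follows that of `y` within `δ₃`, hence never leaves `U`.
    have hxΩ : x ∈ nonwanderingSet f := by
      rw [hΩ, mem_iInter_zpow_image_iff]
      intro i
      exact h₃ (Metric.mem_cthickening_of_dist_le _ _ _ _ (hiter i) ((hy i).trans hle₃))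
    exact hyx (h₂ x hxΩ y hyΩ (Gam_mono f hle₂ x hy))
  have hsplit : Gam f δ x = {x} ∪ (Gam f δ x \ {x}) := by
    rw [Set.union_sdiff_self, Set.union_eq_self_of_subset_left]
    simpa using self_mem_Gam f (by positivity) x
  have hnull : μ (Gam f δ x \ {x}) = 0 := by
    rw [← Set.biUnion_of_singleton (Gam f δ x \ {x})]
    exact (measure_biUnion_null_iff hfin.sdiff.countable).2 fun y hy => hzero y hy.1 hy.2
  refine le_antisymm ?_ (measure_mono (by simpa using self_mem_Gam f (by positivity) x))
  calc μ (Gam f δ x) ≤ μ {x} + μ (Gam f δ x \ {x}) := by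
        conv_lhs => rw [hsplit]
        exact measure_union_le _ _
    _ = μ {x} := by rw [hnull, add_zero]

/-! ### Dynamics read off from clopen itineraries -/

/-- By compactness a clopen set has positive distance from its complement. Hence, for small `δ`,
points of one `Γ_δ(x)` have the same itinerary. -/
theorem IsClopen.exists_dist_le_imp_mem_iff {X : Type*} [MetricSpace X] [CompactSpace X]
    {A : Set X} (hA : IsClopen A) :
    ∃ δ : ℝ, 0 < δ ∧ ∀ x y, dist x y ≤ δ → (x ∈ A ↔ y ∈ A) := by
  obtain ⟨δ, hδ, h⟩ := hA.isClosed.isCompact.exists_cthickening_subset_open hA.isOpen subset_rfl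
  refine ⟨δ, hδ, fun x y hxy => ⟨fun hx => ?_, fun hy => ?_⟩⟩
  · exact h (Metric.mem_cthickening_of_dist_le _ _ _ _ hx (by rwa [dist_comm]))
  · exact h (Metric.mem_cthickening_of_dist_le _ _ _ _ hy hxy)

/-- A fixed point `p` and clopen sets `A b` visited at most once by every orbit, where every orbit
other than that of `p` visits some `A b`: if at most `N + 1` points share an itinerary, and if there
are `N + 1` points whose orbits stay together with respect to an arbitrarily fine cover, then the
homeomorphism has the properties of the `N`-th map, with non-wandering set `{p}`. -/
theorem isArtigue_of_itinerary {X : Type*} [MetricSpace X] [CompactSpace X] (N : ℕ) (f : X ≃ₜ X)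
    (p : X) (hp : f p = p) (A : Bool → Set X) (hA : ∀ b, IsClopen (A b))
    (hvisit : ∀ x, x ≠ p → ∃ b, ∃ i : ℤ, (f ^ i) x ∈ A b)
    (honce : ∀ x b, ∀ i j : ℤ, (f ^ i) x ∈ A b → (f ^ j) x ∈ A b → i = j)
    (hcard : ∀ x, {y | ∀ (i : ℤ) (b), (f ^ i) x ∈ A b ↔ (f ^ i) y ∈ A b}.encard ≤ (N + 1 : ℕ))
    (hclose : ∀ U : X → Set X, (∀ x, IsOpen (U x) ∧ x ∈ U x) → ∃ (x : X) (T : Set X),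
      ((N + 1 : ℕ) : ℕ∞) ≤ T.encard ∧
        ∀ y ∈ T, ∀ i : ℤ, ∃ z, (f ^ i) x ∈ U z ∧ (f ^ i) y ∈ U z) :
    IsArtigue N f := by
  have hpA : ∀ b, p ∉ A b := by
    intro b hb
    have := honce p b 0 1 (by rwa [f.zpow_apply_of_fixed hp]) (by rwa [f.zpow_apply_of_fixed hp])
    omega
  have hΩ : nonwanderingSet f = {p} := by
    ext x
    refine ⟨fun hx => ?_, ?_⟩
    · by_contra hxp
      obtain ⟨b, i, hi⟩ := hvisit x hxp
      -- A return to this neighbourhood of `x` would make some orbit visit `A b` at the two times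
      -- `i` and `i + n`.
      obtain ⟨n, hn, _, ⟨y, hy, rfl⟩, hy'⟩ :=
        hx ((f ^ i) ⁻¹' A b) ((hA b).isOpen.preimage (f ^ i).continuous) hi
      have h2 : (f ^ (i + n)) y ∈ A b := by
        rw [zpow_add, zpow_natCast]; exact hy'
      have := honce y b _ _ hy h2
      omega
    · rintro rfl
      exact mem_nonwanderingSet_of_pow_apply_eq f le_rfl (by simpa using hp)
  refine ⟨?_, ?_, ?_, ?_⟩
  · choose δ hδ h using fun b => (hA b).exists_dist_le_imp_mem_iff
    refine ⟨min (δ false) (δ true), lt_min (hδ _) (hδ _), fun x => ?_⟩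
    have hsub : Gam f (min (δ false) (δ true)) x ⊆
        {y | ∀ (i : ℤ) (b), (f ^ i) x ∈ A b ↔ (f ^ i) y ∈ A b} := by
      intro y hy i b
      refine h b _ _ ((hy i).trans ?_)
      cases b
      · exact min_le_left _ _
      · exact min_le_right _ _
    exact (Set.encard_le_encard hsub).trans (hcard x)
  · rintro ⟨δ, hδ, h⟩
    obtain ⟨x, T, hT, hclose⟩ := hclose (fun z => Metric.ball z (δ / 2))
      fun z => ⟨Metric.isOpen_ball, Metric.mem_ball_self (by positivity)⟩
    have hsub : T ⊆ Gam f δ x := by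
      intro y hy i
      obtain ⟨z, hx, hy⟩ := hclose y hy i
      have := dist_triangle_right ((f ^ i) x) ((f ^ i) y) z
      rw [Metric.mem_ball] at hx hy
      linarith
    have := hT.trans ((Set.encard_le_encard hsub).trans (h x))
    have : N + 1 ≤ N := by exact_mod_cast this
    omega
  · rw [hΩ]
    exact ⟨1, one_pos, fun x hx y hy _ => by rw [hx, hy]⟩
  · refine ⟨(A false ∪ A true)ᶜ, ((hA _).union (hA _)).compl.isOpen, ?_⟩
    ext x
    rw [hΩ, mem_iInter_zpow_image_iff]
    constructor
    · rintro rfl i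
      rw [f.zpow_apply_of_fixed hp]
      simp [hpA]
    · intro h
      by_contra hx
      obtain ⟨b, i, hi⟩ := hvisit x hx
      have := h i
      cases b <;> simp_all

/-! ### The countable compact space and its homeomorphisms -/

/-- Countably many convergent sequences whose limits converge to a further point, if `C` is
countable and discrete. -/
abbrev SequenceCluster (C : Type*) [TopologicalSpace C] : Type _ := OnePoint (C × OnePoint ℕ)

namespace SequenceCluster


variable {C : Type*} [TopologicalSpace C]

/-- The `m`-th point of the `c`-th sequence. -/
def pt (c : C) (m : ℕ) : SequenceCluster C := ((c, (m : OnePoint ℕ)) : C × OnePoint ℕ)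

/-- The limit of the `c`-th sequence. -/
def lim (c : C) : SequenceCluster C := ((c, ∞) : C × OnePoint ℕ)

/-- The `c`-th sequence with its limit. -/
def column (c : C) : Set (SequenceCluster C) := insert (lim c) (Set.range (pt c))

theorem cases (x : SequenceCluster C) : x = ∞ ∨ (∃ c, x = lim c) ∨ ∃ c m, x = pt c m := by
  induction x using OnePoint.rec with
  | infty => exact Or.inl rfl
  | coe x =>
    obtain ⟨c, y⟩ := x
    induction y using OnePoint.rec with
    | infty => exact Or.inr (Or.inl ⟨c, rfl⟩)
    | coe m => exact Or.inr (Or.inr ⟨c, m, rfl⟩)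

@[simp] theorem pt_inj {c c' : C} {m m' : ℕ} : pt c m = pt c' m' ↔ c = c' ∧ m = m' := by
  simp [pt]

@[simp] theorem lim_inj {c c' : C} : lim c = lim c' ↔ c = c' := by
  simp [lim]

@[simp] theorem pt_ne_lim {c c' : C} {m : ℕ} : pt c m ≠ lim c' := by
  simp [pt, lim]

@[simp] theorem pt_ne_infty {c : C} {m : ℕ} : pt c m ≠ ∞ := OnePoint.coe_ne_infty _

@[simp] theorem lim_ne_infty {c : C} : lim c ≠ ∞ := OnePoint.coe_ne_infty _

@[simp] theorem lim_mem_column {c c' : C} : lim c ∈ column c' ↔ c = c' := by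
  simp [column]

@[simp] theorem pt_mem_column {c c' : C} {m : ℕ} : pt c m ∈ column c' ↔ c = c' := by
  simp [column, eq_comm (a := c)]

@[simp] theorem infty_notMem_column {c : C} : ∞ ∉ column c := by
  simp [column, eq_comm (a := (∞ : SequenceCluster C))]

/-- The map that permutes the points of the sequences by `σ` and their limits by `τ`. -/
def permMap (σ : Equiv.Perm (C × ℕ)) (τ : Equiv.Perm C) : SequenceCluster C → SequenceCluster C :=
  fun x => x.elim ∞ fun y => y.2.elim (lim (τ y.1)) fun m => pt (σ (y.1, m)).1 (σ (y.1, m)).2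

variable (σ : Equiv.Perm (C × ℕ)) (τ : Equiv.Perm C)

@[simp] theorem permMap_infty : permMap σ τ ∞ = ∞ := rfl

@[simp] theorem permMap_lim (c : C) : permMap σ τ (lim c) = lim (τ c) := rfl

@[simp] theorem permMap_pt (c : C) (m : ℕ) :
    permMap σ τ (pt c m) = pt (σ (c, m)).1 (σ (c, m)).2 := rfl

theorem permMap_symm_permMap (x : SequenceCluster C) :
    permMap σ.symm τ.symm (permMap σ τ x) = x := by
  rcases cases x with rfl | ⟨c, rfl⟩ | ⟨c, m, rfl⟩ <;> simp

variable [DiscreteTopology C]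

theorem isOpen_prod_iff {W : Set (C × OnePoint ℕ)} :
    IsOpen W ↔ ∀ c, (c, ∞) ∈ W → {m : ℕ | (c, (m : OnePoint ℕ)) ∉ W}.Finite := by
  have h1 : IsOpen W ↔ ∀ c, IsOpen (Prod.mk c ⁻¹' W) := by
    refine ⟨fun h c => h.preimage (by fun_prop), fun h => ?_⟩
    have : W = ⋃ c, {c} ×ˢ (Prod.mk c ⁻¹' W) := by
      ext ⟨c, y⟩; simp
    rw [this]
    exact isOpen_iUnion fun c => (isOpen_discrete _).prod (h c)
  rw [h1]
  refine forall_congr' fun c => ?_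
  rw [OnePoint.isOpen_def]
  simp only [isOpen_discrete, and_true, isCompact_iff_finite]
  rfl

/-- Each column is compact, so a closed set avoiding `∞` is compact exactly when it meets finitely
many columns. -/
theorem isOpen_iff {V : Set (SequenceCluster C)} :
    IsOpen V ↔ (∀ c, lim c ∈ V → {m | pt c m ∉ V}.Finite) ∧
      (∞ ∈ V → {c | ¬ column c ⊆ V}.Finite) := by
  rw [OnePoint.isOpen_def, and_comm]
  have h1 : IsOpen ((↑) ⁻¹' V : Set (C × OnePoint ℕ)) ↔
      ∀ c, lim c ∈ V → {m | pt c m ∉ V}.Finite := isOpen_prod_iff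
  rw [h1]
  refine and_congr_right fun hV => imp_congr_right fun _ => ?_
  have hfst : {c | ¬ column c ⊆ V} = Prod.fst '' ((↑) ⁻¹' V : Set (C × OnePoint ℕ))ᶜ := by
    ext c
    constructor
    · intro h
      obtain ⟨x, hx, hxV⟩ := Set.not_subset.1 h
      rcases hx with rfl | ⟨m, rfl⟩
      · exact ⟨(c, ∞), hxV, rfl⟩
      · exact ⟨(c, (m : OnePoint ℕ)), hxV, rfl⟩
    · rintro ⟨⟨c, y⟩, hy, rfl⟩ h
      apply hy
      induction y using OnePoint.rec with
      | infty => exact h (lim_mem_column.2 rfl)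
      | coe m => exact h (pt_mem_column.2 rfl)
  rw [hfst]
  constructor
  · exact fun h => (h.image continuous_fst).finite_of_discrete
  · intro h
    have hc : IsCompact ((Prod.fst '' ((↑) ⁻¹' V : Set (C × OnePoint ℕ))ᶜ) ×ˢ
        (Set.univ : Set (OnePoint ℕ))) := h.isCompact.prod isCompact_univ
    refine hc.of_isClosed_subset (h1.2 hV).isClosed_compl ?_
    exact fun x hx => ⟨⟨x, hx, rfl⟩, trivial⟩

theorem isClopen_column (c : C) : IsClopen (column c) := by
  constructor
  · rw [← isOpen_compl_iff, isOpen_iff]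
    constructor
    · intro c' h
      simp_all
    · refine fun _ => (Set.finite_singleton c).subset fun c' h => ?_
      obtain ⟨x, hx, hx'⟩ := Set.not_subset.1 h
      rcases hx with rfl | ⟨m, rfl⟩ <;> simp_all
  · rw [isOpen_iff]
    constructor
    · intro c' h
      simp_all
    · simp

theorem isClopen_singleton_pt (c : C) (m : ℕ) : IsClopen {pt c m} := by
  refine ⟨isClosed_singleton, ?_⟩
  rw [isOpen_iff]
  constructor
  · intro c' h
    simp [eq_comm (a := lim c')] at h
  · intro h
    simp [eq_comm (a := (∞ : SequenceCluster C))] at h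

/-- The indicators of the columns and of the isolated points are countably many continuous functions
that separate points; they embed the compact space in a metrizable product. -/
instance [Countable C] : TopologicalSpace.MetrizableSpace (SequenceCluster C) := by
  let g : SequenceCluster C → (C → Bool) × (C × ℕ → Bool) :=
    fun x => (fun c => (column c).boolIndicator x, fun y => ({pt y.1 y.2} : Set _).boolIndicator x)
  have hg : Continuous g :=
    (continuous_pi fun c => (continuous_boolIndicator_iff_isClopen _).2 (isClopen_column c)).prodMk
      (continuous_pi fun y =>
        (continuous_boolIndicator_iff_isClopen _).2 (isClopen_singleton_pt y.1 y.2))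
  refine (hg.isClosedEmbedding fun x y hxy => ?_).isEmbedding.metrizableSpace
  have h1 : ∀ c, x ∈ column c ↔ y ∈ column c := fun c => by
    rw [Set.mem_iff_boolIndicator, Set.mem_iff_boolIndicator]
    exact iff_of_eq (congrArg (· = true) (congrFun (congrArg Prod.fst hxy) c))
  have h2 : ∀ c m, x = pt c m ↔ y = pt c m := fun c m => by
    rw [← Set.mem_singleton_iff, ← Set.mem_singleton_iff (a := y), Set.mem_iff_boolIndicator,
      Set.mem_iff_boolIndicator]
    exact iff_of_eq (congrArg (· = true) (congrFun (congrArg Prod.snd hxy) (c, m)))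
  rcases cases x with rfl | ⟨c, rfl⟩ | ⟨c, m, rfl⟩
  · rcases cases y with rfl | ⟨c, rfl⟩ | ⟨c, m, rfl⟩
    · rfl
    · simpa using h1 c
    · simpa using h1 c
  · rcases (h1 c).1 (lim_mem_column.2 rfl) with rfl | ⟨m, rfl⟩
    · rfl
    · exact absurd ((h2 c m).2 rfl).symm pt_ne_lim
  · exact ((h2 c m).1 rfl).symm

/-- A permutation of the limits that is induced by a permutation of the points, up to finitely many
points in each sequence, extends to a homeomorphism. -/
theorem continuous_permMap (h₁ : ∀ c, {m | (σ (c, m)).1 ≠ τ c}.Finite)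
    (h₂ : ∀ c, {c' | ∃ m, (σ (c', m)).1 = c}.Finite) : Continuous (permMap σ τ) := by
  rw [continuous_def]
  intro V hV
  rw [isOpen_iff] at hV ⊢
  obtain ⟨hV₁, hV₂⟩ := hV
  constructor
  · intro c hc
    have hinj : Function.Injective fun m => σ (c, m) := by
      intro m m' h
      simpa using h
    refine ((h₁ c).union (((hV₁ (τ c) hc).image (Prod.mk (τ c))).preimage hinj.injOn)).subset ?_
    intro m hm
    by_cases h : (σ (c, m)).1 = τ c
    · right
      refine ⟨(σ (c, m)).2, ?_, Prod.ext h.symm rfl⟩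
      rw [← h]
      exact hm
    · exact Or.inl h
  · intro hp
    have hB := hV₂ hp
    refine ((hB.biUnion fun c _ => h₂ c).union (hB.preimage τ.injective.injOn)).subset ?_
    intro c hc
    obtain ⟨x, hx, hxV⟩ := Set.not_subset.1 hc
    rcases hx with rfl | ⟨m, rfl⟩
    · right
      exact fun h => hxV (h (lim_mem_column.2 rfl))
    · left
      simp only [Set.mem_iUnion]
      exact ⟨(σ (c, m)).1, fun h => hxV (h (pt_mem_column.2 rfl)), m, rfl⟩

/-- The homeomorphism that permutes the points of the sequences by `σ` and their limits by `τ`. -/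
def permHomeo (h₁ : ∀ c, {m | (σ (c, m)).1 ≠ τ c}.Finite)
    (h₂ : ∀ c, {c' | ∃ m, (σ (c', m)).1 = c}.Finite) : SequenceCluster C ≃ₜ SequenceCluster C :=
  Continuous.homeoOfEquivCompactToT2
    (f := { toFun := permMap σ τ
            invFun := permMap σ.symm τ.symm
            left_inv := permMap_symm_permMap σ τ
            right_inv := permMap_symm_permMap σ.symm τ.symm })
    (continuous_permMap σ τ h₁ h₂)

end SequenceCluster

open SequenceCluster

/-! ### The shift on words with two markers -/

/-- A word with its first marker at `a` and its second marker at `a + k + 1` is put into the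
sequence that belongs to the marker closer to the origin. -/
def nearMarker (a : ℤ) (k : ℕ) : ℤ × Bool :=
  if a.natAbs ≤ (a + k + 1).natAbs then (a, false) else (a + k + 1, true)

theorem nearMarker_eq_false_iff {a c : ℤ} {k : ℕ} :
    nearMarker a k = (c, false) ↔ a = c ∧ a.natAbs ≤ (a + k + 1).natAbs := by
  unfold nearMarker
  split_ifs with h <;> simp [h]

theorem nearMarker_eq_true_iff {a c : ℤ} {k : ℕ} :
    nearMarker a k = (c, true) ↔ a + k + 1 = c ∧ (a + k + 1).natAbs < a.natAbs := by
  unfold nearMarker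
  split_ifs with h
  · simp [h]
  · simp only [Prod.mk.injEq, and_true]
    omega

/-- The near marker can be fixed while the other recedes; a gap of at least `2 * c.natAbs` keeps the
other one farther from the origin. -/
theorem infinite_nearMarker_fiber (N : ℕ) (c : ℤ × Bool) :
    Infinite {e : ℤ × ℕ × Fin (N + 1) // nearMarker e.1 e.2.1 = c} := by
  obtain ⟨c, b⟩ := c
  cases b
  · refine Infinite.of_injective
      (fun n : ℕ => ⟨(c, n + 2 * c.natAbs, 0), nearMarker_eq_false_iff.2 ⟨rfl, ?_⟩⟩) ?_
    · dsimp only; omega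
    · intro n n' h
      simpa using h
  · refine Infinite.of_injective
      (fun n : ℕ => ⟨(c - (n + 2 * c.natAbs : ℕ) - 1, n + 2 * c.natAbs, 0),
        nearMarker_eq_true_iff.2 ⟨?_, ?_⟩⟩) ?_
    · push_cast; ring
    · dsimp only; omega
    · intro n n' h
      have := congrArg (fun e => e.1.2.1) h
      simpa using this

/-- All fibres are countably infinite, so the words fill the sequences of one fixed space for every
`N`. -/
theorem exists_equiv_fst_eq_nearMarker (N : ℕ) :
    ∃ φ : ℤ × ℕ × Fin (N + 1) ≃ (ℤ × Bool) × ℕ, ∀ e, (φ e).1 = nearMarker e.1 e.2.1 := by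
  have hne : ∀ c : ℤ × Bool, Nonempty
      ({e : ℤ × ℕ × Fin (N + 1) // nearMarker e.1 e.2.1 = c} ≃
        {y : (ℤ × Bool) × ℕ // y.1 = c}) := by
    intro c
    have := infinite_nearMarker_fiber N c
    have : Infinite {y : (ℤ × Bool) × ℕ // y.1 = c} :=
      Infinite.of_injective (fun n : ℕ => ⟨(c, n), rfl⟩) fun n n' h => by simpa using h
    exact nonempty_equiv_of_countable
  exact ⟨Equiv.ofFiberEquiv fun c => (hne c).some, fun e => Equiv.ofFiberEquiv_map _ e⟩

/-- The shift of all words with two markers, by one place. -/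
def wordShift (N : ℕ) : Equiv.Perm (ℤ × ℕ × Fin (N + 1)) :=
  (Equiv.addRight 1).prodCongr (Equiv.refl _)

theorem finite_box (N : ℕ) (A : ℤ) (K : ℕ) :
    {e : ℤ × ℕ × Fin (N + 1) | e.1 ∈ Set.Icc (-A) A ∧ e.2.1 ∈ Set.Iic K}.Finite :=
  ((Set.finite_Icc (-A) A).prod ((Set.finite_Iic K).prod (Set.finite_univ (α := Fin (N + 1))))).subset
    fun _ he => ⟨he.1, he.2, trivial⟩

/-- The shift on the words with at most one first marker `a` and at most one second marker, placed
after `a`, where the words with both markers are taken `N + 1` times. -/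
theorem exists_shift_homeomorph (N : ℕ) :
    ∃ (φ : ℤ × ℕ × Fin (N + 1) ≃ (ℤ × Bool) × ℕ)
      (f : SequenceCluster (ℤ × Bool) ≃ₜ SequenceCluster (ℤ × Bool)),
      (∀ e, (φ e).1 = nearMarker e.1 e.2.1) ∧ f ∞ = ∞ ∧
      (∀ a b, f (lim (a, b)) = lim (a + 1, b)) ∧
      ∀ a k j, f (pt (φ (a, k, j)).1 (φ (a, k, j)).2) =
        pt (φ (a + 1, k, j)).1 (φ (a + 1, k, j)).2 := by
  obtain ⟨φ, hφ⟩ := exists_equiv_fst_eq_nearMarker N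
  let σ : Equiv.Perm ((ℤ × Bool) × ℕ) := φ.symm.trans ((wordShift N).trans φ)
  let τ : Equiv.Perm (ℤ × Bool) := (Equiv.addRight 1).prodCongr (Equiv.refl _)
  have hσ : ∀ a k j, σ (φ (a, k, j)) = φ (a + 1, k, j) := fun a k j => by simp [σ, wordShift]
  have h₁ : ∀ c, {m | (σ (c, m)).1 ≠ τ c}.Finite := by
    rintro ⟨c, b⟩
    have hinj : Function.Injective fun m => φ.symm ((c, b), m) := fun m m' h => by simpa using h
    -- The shift changes which marker is nearer only if the gap `k` is at most about twice `|c|`;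
    -- then the first marker is within `3|c| + 3` of the origin.
    refine ((finite_box N (3 * c.natAbs + 3) (2 * c.natAbs + 2)).preimage
      hinj.injOn).subset fun m hm => ?_
    obtain ⟨⟨a, k, j⟩, he⟩ := φ.surjective ((c, b), m)
    have hdom := hφ (a, k, j)
    have hm' : (σ ((c, b), m)).1 ≠ (c + 1, b) := hm
    rw [← he, hσ, hφ] at hm'
    rw [he] at hdom
    rw [Set.mem_preimage, ← he, φ.symm_apply_apply]
    dsimp only at hm' hdom
    simp only [Set.mem_ofPred_eq, Set.mem_Icc, Set.mem_Iic]
    cases b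
    · obtain ⟨h1, h2⟩ := nearMarker_eq_false_iff.1 hdom.symm
      rw [Ne, nearMarker_eq_false_iff] at hm'
      omega
    · obtain ⟨h1, h2⟩ := nearMarker_eq_true_iff.1 hdom.symm
      rw [Ne, nearMarker_eq_true_iff] at hm'
      omega
  have h₂ : ∀ c, {c' | ∃ m, (σ (c', m)).1 = c}.Finite := by
    rintro ⟨c, b⟩
    -- The distance from the origin to the nearest marker changes by at most one under the shift.
    refine ((Set.finite_Icc (-(c.natAbs + 1 : ℤ)) (c.natAbs + 1)).prod
      (Set.finite_univ (α := Bool))).subset ?_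
    rintro ⟨c', b'⟩ ⟨m, hm⟩
    refine ⟨?_, trivial⟩
    obtain ⟨⟨a, k, j⟩, he⟩ := φ.surjective ((c', b'), m)
    have hdom := hφ (a, k, j)
    rw [← he, hσ, hφ] at hm
    rw [he] at hdom
    simp only [Set.mem_Icc]
    cases b <;> cases b' <;>
      simp only [@eq_comm _ (_, _) (nearMarker _ _), nearMarker_eq_false_iff,
        nearMarker_eq_true_iff] at hm hdom <;> omega
  refine ⟨φ, permHomeo σ τ h₁ h₂, hφ, rfl, fun _ _ => rfl, fun a k j => ?_⟩
  rw [← hσ]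
  rfl

/-- The topological form of the properties of the shift from which all others follow. -/
theorem exists_homeomorph_itinerary (N : ℕ) :
    ∃ f : SequenceCluster (ℤ × Bool) ≃ₜ SequenceCluster (ℤ × Bool), f ∞ = ∞ ∧
      (∀ x, x ≠ ∞ → ∃ b, ∃ i : ℤ, (f ^ i) x ∈ column (0, b)) ∧
      (∀ x b, ∀ i j : ℤ, (f ^ i) x ∈ column (0, b) → (f ^ j) x ∈ column (0, b) → i = j) ∧
      (∀ x, {y | ∀ (i : ℤ) (b), (f ^ i) x ∈ column (0, b) ↔ (f ^ i) y ∈ column (0, b)}.encard ≤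
        (N + 1 : ℕ)) ∧
      ∀ U : SequenceCluster (ℤ × Bool) → Set (SequenceCluster (ℤ × Bool)),
        (∀ x, IsOpen (U x) ∧ x ∈ U x) →
        ∃ (x : SequenceCluster (ℤ × Bool)) (T : Set (SequenceCluster (ℤ × Bool))),
          ((N + 1 : ℕ) : ℕ∞) ≤ T.encard ∧
            ∀ y ∈ T, ∀ i : ℤ, ∃ z, (f ^ i) x ∈ U z ∧ (f ^ i) y ∈ U z := by
  obtain ⟨φ, f, hφ, hf₀, hf₁, hf₂⟩ := exists_shift_homeomorph N
  let w : ℤ → ℕ → Fin (N + 1) → SequenceCluster (ℤ × Bool) :=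
    fun a k j => pt (φ (a, k, j)).1 (φ (a, k, j)).2
  have hcases : ∀ x, x = ∞ ∨ (∃ a b, x = lim (a, b)) ∨ ∃ a k j, x = w a k j := by
    intro x
    rcases SequenceCluster.cases x with h | ⟨⟨a, b⟩, h⟩ | ⟨c, m, h⟩
    · exact Or.inl h
    · exact Or.inr (Or.inl ⟨a, b, h⟩)
    · obtain ⟨⟨a, k, j⟩, he⟩ := φ.surjective (c, m)
      exact Or.inr (Or.inr ⟨a, k, j, by simp only [w, he, h]⟩)
  have hw : Function.Injective fun e : ℤ × ℕ × Fin (N + 1) => w e.1 e.2.1 e.2.2 := by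
    intro e e' h
    have := pt_inj.1 h
    exact φ.injective (Prod.ext this.1 this.2)
  have hi₀ : ∀ i : ℤ, (f ^ i) ∞ = ∞ := f.zpow_apply_of_fixed hf₀
  have hi₁ : ∀ (i a : ℤ) (b), (f ^ i) (lim (a, b)) = lim (a + i, b) := fun i a b =>
    f.zpow_apply_of_semiconj (fun t => lim (t, b)) (fun t => hf₁ t b) i a
  have hi₂ : ∀ (i a : ℤ) (k j), (f ^ i) (w a k j) = w (a + i) k j := fun i a k j =>
    f.zpow_apply_of_semiconj (fun t => w t k j) (fun t => hf₂ t k j) i a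
  have hwcol : ∀ a k j c, w a k j ∈ column c ↔ nearMarker a k = c := by
    intro a k j c
    rw [pt_mem_column, hφ]
  have hv₁ : ∀ (i a : ℤ) (b b'), (f ^ i) (lim (a, b)) ∈ column (0, b') ↔ i = -a ∧ b = b' := by
    intro i a b b'
    rw [hi₁, lim_mem_column, Prod.mk.injEq]
    exact and_congr_left fun _ => by omega
  -- A marker at the origin is strictly the nearest, because the markers are `k + 1 ≥ 1` apart; so
  -- each marker is seen exactly once.
  have hv₂ : ∀ (i a : ℤ) (k j b), (f ^ i) (w a k j) ∈ column (0, b) ↔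
      i = -a - cond b (k + 1) 0 := by
    intro i a k j b
    rw [hi₂, hwcol]
    cases b
    · rw [nearMarker_eq_false_iff]
      simp only [cond_false]
      omega
    · rw [nearMarker_eq_true_iff]
      simp only [cond_true]
      omega
  refine ⟨f, hf₀, ?_, ?_, ?_, ?_⟩
  · intro x hx
    rcases hcases x with rfl | ⟨a, b, rfl⟩ | ⟨a, k, j, rfl⟩
    · exact absurd rfl hx
    · exact ⟨b, -a, (hv₁ ..).2 ⟨rfl, rfl⟩⟩
    · exact ⟨false, _, (hv₂ ..).2 rfl⟩
  · intro x b i j hi hj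
    rcases hcases x with rfl | ⟨a, b, rfl⟩ | ⟨a, k, j, rfl⟩
    · rw [hi₀] at hi
      exact absurd hi infty_notMem_column
    · rw [hv₁] at hi hj
      omega
    · rw [hv₂] at hi hj
      omega
  · intro x
    have hfew : ∀ (s : Set (SequenceCluster (ℤ × Bool))) (y), s ⊆ {y} →
        s.encard ≤ (N + 1 : ℕ) := fun s y h =>
      (Set.encard_le_encard h).trans (by
        rw [Set.encard_singleton]; exact_mod_cast Nat.le_add_left 1 N)
    rcases hcases x with rfl | ⟨a, b, rfl⟩ | ⟨a, k, j, rfl⟩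
    · refine hfew _ ∞ fun y hy => ?_
      rcases hcases y with rfl | ⟨a, b, rfl⟩ | ⟨a, k, j, rfl⟩
      · rfl
      · have := (hy (-a) b).2 ((hv₁ ..).2 ⟨rfl, rfl⟩)
        rw [hi₀] at this
        exact absurd this infty_notMem_column
      · have := (hy _ false).2 ((hv₂ ..).2 rfl)
        rw [hi₀] at this
        exact absurd this infty_notMem_column
    · refine hfew _ (lim (a, b)) fun y hy => ?_
      rcases hcases y with rfl | ⟨a', b', rfl⟩ | ⟨a', k, j, rfl⟩
      · have := (hy (-a) b).1 ((hv₁ ..).2 ⟨rfl, rfl⟩)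
        rw [hi₀] at this
        exact absurd this infty_notMem_column
      · obtain ⟨h1, h2⟩ := (hv₁ ..).1 ((hy (-a) b).1 ((hv₁ ..).2 ⟨rfl, rfl⟩))
        rw [neg_inj.1 h1, h2]
        rfl
      -- A limit point sees only one of the two markers, a word with both sees each.
      · have h1 := ((hv₁ ..).1 ((hy _ false).2 ((hv₂ ..).2 rfl))).2
        have h2 := ((hv₁ ..).1 ((hy _ true).2 ((hv₂ ..).2 rfl))).2
        rw [h1] at h2
        exact absurd h2 (by decide)
    · have hsub : {y | ∀ (i : ℤ) (b), (f ^ i) (w a k j) ∈ column (0, b) ↔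
          (f ^ i) y ∈ column (0, b)} ⊆ Set.range (w a k) := by
        intro y hy
        rcases hcases y with rfl | ⟨a', b', rfl⟩ | ⟨a', k', j', rfl⟩
        · have := (hy _ false).1 ((hv₂ ..).2 rfl)
          rw [hi₀] at this
          exact absurd this infty_notMem_column
        · have h1 := ((hv₁ ..).1 ((hy _ false).1 ((hv₂ ..).2 rfl))).2
          have h2 := ((hv₁ ..).1 ((hy _ true).1 ((hv₂ ..).2 rfl))).2
          rw [h1] at h2
          exact absurd h2 (by decide)
        · have h1 := (hv₂ ..).1 ((hy _ false).1 ((hv₂ ..).2 rfl))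
          have h2 := (hv₂ ..).1 ((hy _ true).1 ((hv₂ ..).2 rfl))
          simp only [cond_false, cond_true] at h1 h2
          obtain rfl : a = a' := by omega
          obtain rfl : k = k' := by omega
          exact ⟨j', rfl⟩
      refine (Set.encard_le_encard hsub).trans ?_
      rw [← Set.image_univ]
      refine (Set.encard_image_le _ _).trans ?_
      simp
  · intro U hU
    have hfar := (isOpen_iff.1 (hU ∞).1).2 (hU ∞).2
    have hnear : ∀ c : ℤ × Bool, {m | pt c m ∉ U (lim c)}.Finite := fun c =>
      (isOpen_iff.1 (hU (lim c)).1).1 c (hU (lim c)).2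
    -- Only finitely many points are neither covered by `U ∞` along with their whole column nor near
    -- their limit. A gap `k` occurring in none of them works at every time.
    have hbad : (⋃ c ∈ {c | ¬ column c ⊆ U ∞}, Prod.mk c '' {m | pt c m ∉ U (lim c)}).Finite :=
      hfar.biUnion fun c _ => (hnear c).image _
    obtain ⟨k, hk⟩ := (hbad.image fun y => (φ.symm y).2.1).exists_notMem
    have hgood : ∀ a, ∃ z, ∀ j, w a k j ∈ U z := by
      intro a
      by_cases hc : column (nearMarker a k) ⊆ U ∞
      · exact ⟨∞, fun j => hc ((hwcol ..).2 rfl)⟩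
      · refine ⟨lim (nearMarker a k), fun j => ?_⟩
        by_contra hj
        refine hk ⟨φ (a, k, j), ?_, by simp⟩
        simp only [Set.mem_iUnion]
        refine ⟨nearMarker a k, hc, (φ (a, k, j)).2, ?_, Prod.ext (hφ (a, k, j)).symm rfl⟩
        change pt _ _ ∉ _
        have : w a k j = pt (nearMarker a k) (φ (a, k, j)).2 := by simp only [w, hφ]
        rwa [← this]
    refine ⟨w 0 k 0, Set.range (w 0 k), ?_, ?_⟩
    · have hinj : Function.Injective (w 0 k) := fun j j' h => by
        have := @hw (0, k, j) (0, k, j') h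
        simpa using this
      rw [← Set.image_univ, hinj.encard_image]
      simp
    · rintro _ ⟨j, rfl⟩ i
      obtain ⟨z, hz⟩ := hgood (0 + i)
      exact ⟨z, by rw [hi₂]; exact hz 0, by rw [hi₂]; exact hz j⟩

/-! ### Conclusion -/

theorem exists_isArtigue :
    ∃ (S : Type) (_ : MetricSpace S) (_ : CompactSpace S), ∀ N : ℕ, ∃ f : S ≃ₜ S,
      IsArtigue N f := by
  let m : MetricSpace (SequenceCluster (ℤ × Bool)) :=
    TopologicalSpace.metrizableSpaceMetric _
  refine ⟨SequenceCluster (ℤ × Bool), m, inferInstance, fun N => ?_⟩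
  obtain ⟨f, h₀, h₁, h₂, h₃, h₄⟩ := exists_homeomorph_itinerary N
  exact ⟨f, isArtigue_of_itinerary N f ∞ h₀ (fun b => column (0, b))
    (fun b => isClopen_column _) h₁ h₂ h₃ h₄⟩

theorem mainTheorem10 :
    -- every homeomorphism with the properties of the `N`-th map is strongly measure expansive
    (∀ (X : Type*) [MetricSpace X] [CompactSpace X] [MeasurableSpace X] [BorelSpace X]
      (N : ℕ) (f : X ≃ₜ X), IsArtigue N f → IsStronglyMeasureExpansive f) ∧
    -- one compact metric space carries such maps for all `N`
    (∃ (S : Type) (_ : MetricSpace S) (_ : CompactSpace S) (_ : MeasurableSpace S)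
      (_ : BorelSpace S) (f : ℕ → (S ≃ₜ S)),
      ∀ N : ℕ, IsArtigue N (f N) ∧ IsStronglyMeasureExpansive (f N) ∧
        (1 ≤ N → ¬ IsExpansive (f N))) ∧
    -- strong measure expansiveness does not imply expansiveness
    ¬ (∀ (X : Type) [MetricSpace X] [CompactSpace X] [MeasurableSpace X] [BorelSpace X]
      (f : X ≃ₜ X), IsStronglyMeasureExpansive f → IsExpansive f) := by
  obtain ⟨S, _, _, hS⟩ := exists_isArtigue
  choose f hf using hS
  borelize S
  have hstrong : ∀ N, IsStronglyMeasureExpansive (f N) := fun N =>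
    isStronglyMeasureExpansive_of_isNExpansive _ _ (hf N).expansive_succ
      (hf N).expansive_nonwandering (hf N).isolated_nonwandering
  -- Expansive means `1`-expansive, hence `N`-expansive as soon as `N ≥ 1`.
  have hnot : ∀ N, 1 ≤ N → ¬ IsExpansive (f N) := fun N hN h =>
    (hf N).not_expansive (h.isNExpansive_one.mono hN)
  refine ⟨?_, ⟨S, inferInstance, inferInstance, inferInstance, inferInstance, f,
    fun N => ⟨hf N, hstrong N, hnot N⟩⟩, fun h => hnot 1 le_rfl (h S (f 1) (hstrong 1))⟩
  intro X _ _ _ _ N g hg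
  exact isStronglyMeasureExpansive_of_isNExpansive _ _ hg.expansive_succ
    hg.expansive_nonwandering hg.isolated_nonwandering
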